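/- Fix positive integers $\rho_1,\rho_2,\dots$. A composition $\lambda=(\lambda_1,\dots,\lambda_\ell)$ of $n\ge 1$ (a finite sequence of positive integers with sum $n$) is called constrained if $\lambda_j\ge\rho_j$ for $1\le j\le\ell-1$; write $\Lambda_j=\lambda_j+\dots+\lambda_\ell$. Constrained sampling turns a constrained composition $\lambda$ of $n+1$ into a random constrained composition of $n$: for $j=1,2,\dots,\ell-1$ in turn, if no part has been changed yet, then with probability $(\lambda_j-\rho_j)/(\Lambda_j-\rho_j)$ the part $\lambda_j$ is replaced by $\lambda_j-1$ and the procedure stops, and with the complementary probability $\Lambda_{j+1}/(\Lambda_j-\rho_j)$ it passes to $j+1$; if it reaches $j=\ell$, the last part is replaced by $\lambda_\ell-1$ (and removed if it becomes $0$). A constrained composition structure is a sequence $(\mathcal C_n)_{n\ge1}$ of random constrained compositions, $\mathcal C_n$ being a composition of $n$, such that for every $n\ge 1$ the composition obtained from $\mathcal C_{n+1}$ by constrained sampling has the same law as $\mathcal C_n$. Put $p(\lambda)=\mathbb P(\mathcal C_n=\lambda)$ for a constrained composition $\lambda$ of $n$. A decrement matrix is an array $q(n:m)\ge0$, $1\le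 m\le n$, with $\sum_{m=1}^n q(n:m)=1$ for every $n\ge1$. Let $(\mathcal C_n)$ be a constrained composition structure. (1) There are decrement matrices $q_1,q_2,\dots$ such that $$p(\lambda)=\prod_{k=1}^{\ell}q_k(\Lambda_k:\lambda_k)\qquad\text{for every constrained composition }\lambda=(\lambda_1,\dots,\lambda_\ell) \tag{P}$$ if and only if there are independent $[0,1]$-valued random variables $W_1,W_2,\dots$ such that (P) holds with $$q_k(n:m)=\binom{n-\rho_k}{m-\rho_k}\,\mathbb E\!\left[(1-W_k)^{(m-\rho_k)_+}\,W_k^{\,n-m}\right],\qquad 1\le m\le n. \tag{D}$$ Here $x_+=\max(x,0)$, $0^0=1$, $\binom{a}{-j}=0$ for $a\ge0$, $j>0$, and $\binom{-i}{-j}$ is $1$ if $i=j$ and $0$ otherwise for $i,j>0$. (2) Whenever decrement matrices $q_1,q_2,\dots$ satisfy (P), there are independent $[0,1]$-valued random variables $W_1,W_2,\dots$ such that (D) holds for every $k$ for which, for some $n$, $\mathcal C_n$ has at least $k$ parts with positive probability. -/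

import Mathlib

open MeasureTheory ProbabilityTheory

/-! Sequences that are indexed by `1, 2, …` on paper are indexed here by `0, 1, …`: the terms
`ρ 0, q 0, W 0` are the first ones, and the boxes/parts of a composition are numbered from `0`. -/

/-- The composition `c` is constrained with respect to `ρ`: every part except possibly the last
one is at least as large as the corresponding term of `ρ`. -/
def IsConstrained (ρ : ℕ → ℕ) {n : ℕ} (c : Composition n) : Prop :=
  ∀ (i : ℕ) (h : i + 1 < c.blocks.length), ρ i ≤ c.blocks[i]

/-- Transition probabilities of constrained sampling, by running the algorithm box by box.
`samplingProb ρ k l t` is the probability that the boxes `k, k + 1, …`, occupied by the numbers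
of balls listed in `l`, end up with the (positive) occupancy numbers listed in `t`.

* If `l` has a single box, a ball is deleted from it (and the box disappears if it gets empty).
* If box `k` with `m` balls is followed by other boxes, which contain `s` balls altogether, then
  `ρ k` balls of box `k` are painted black and a ball is drawn uniformly from the `m + s - ρ k`
  white ones. With probability `(m - ρ k) / (m + s - ρ k)` it is in box `k`, where it gets deleted;
  with probability `s / (m + s - ρ k)` it is returned and the algorithm goes on with the other
  boxes. -/
noncomputable def samplingProb (ρ : ℕ → ℕ) : ℕ → List ℕ → List ℕ → ℝ
  | _, [], _ => 0
  | _, [m], t => if t = (if m = 1 then [] else [m - 1]) then 1 else 0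
  | k, m :: m' :: l, t =>
      ((m : ℝ) - ρ k) / ((m : ℝ) + (m' :: l).sum - ρ k) *
          (if t = (m - 1) :: m' :: l then 1 else 0)
        + ((m' :: l).sum : ℝ) / ((m : ℝ) + (m' :: l).sum - ρ k) *
          (match t with
            | [] => 0
            | h :: t' => if h = m then samplingProb ρ (k + 1) (m' :: l) t' else 0)

/-- A constrained composition structure: a sequence of random constrained compositions `C n`
of `n = 1, 2, …` such that `C n` has the same law as the composition derived from `C (n + 1)` by
constrained sampling. (The only composition of `0` carries no information.) -/
structure IsConstrainedCompositionStructure (ρ : ℕ → ℕ) {Ω : Type*} [MeasurableSpace Ω]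
    (P : Measure Ω) (C : ∀ n : ℕ, Ω → Composition n) : Prop where
  measurable : ∀ (n : ℕ) (c : Composition n), MeasurableSet {ω | C n ω = c}
  constrained : ∀ n : ℕ, ∀ᵐ ω ∂P, IsConstrained ρ (C n ω)
  consistent : ∀ n : ℕ, 1 ≤ n → ∀ c : Composition n,
    P.real {ω | C n ω = c} =
      ∑ d : Composition (n + 1),
        P.real {ω | C (n + 1) ω = d} * samplingProb ρ 0 d.blocks c.blocks

/-- A decrement matrix: for each `n ≥ 1` the row `q n 1, …, q n n` is a probability distribution. -/
structure IsDecrementMatrix (q : ℕ → ℕ → ℝ) : Prop where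
  nonneg : ∀ n m : ℕ, 1 ≤ m → m ≤ n → 0 ≤ q n m
  sum_eq_one : ∀ n : ℕ, 1 ≤ n → ∑ m ∈ Finset.Icc 1 n, q n m = 1

/-- The product form: for each constrained composition `c` of `n ≥ 1`, the probability of
`C n = c` is the product over the parts of `q k (Λ k) (c k)`, where `c k` is part number `k` and
`Λ k` is the sum of this part and all later ones. -/
def HasProductForm (ρ : ℕ → ℕ) {Ω : Type*} [MeasurableSpace Ω]
    (P : Measure Ω) (C : ∀ n : ℕ, Ω → Composition n) (q : ℕ → ℕ → ℕ → ℝ) : Prop :=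
  ∀ n : ℕ, 1 ≤ n → ∀ c : Composition n, IsConstrained ρ c →
    P.real {ω | C n ω = c} =
      ∏ k : Fin c.length, q k (c.blocks.drop k).sum (c.blocksFun k)

/-- The binomial coefficient `a` over `b`, zero if only `b` is negative, with the convention that
`-i` over `-j` is `1` if `i = j` and `0` otherwise (`i, j > 0`). -/
def extChoose : ℤ → ℤ → ℕ
  | Int.ofNat a, Int.ofNat b => a.choose b
  | Int.ofNat _, Int.negSucc _ => 0
  | Int.negSucc _, Int.ofNat _ => 0
  | Int.negSucc i, Int.negSucc j => if i = j then 1 else 0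

/-- The matrix `(n - r over m - r) E[(1 - W) ^ (m - r) W ^ (n - m)]`, for `1 ≤ m ≤ n`. The
exponent `m - r` is a natural subtraction, i.e. the positive part, so that the row `n < r` is the
unit mass at `m = n`. -/
noncomputable def residualMatrix (r : ℕ) {Ω : Type*} [MeasurableSpace Ω] (P : Measure Ω)
    (W : Ω → ℝ) (n m : ℕ) : ℝ :=
  (extChoose ((n : ℤ) - r) ((m : ℤ) - r) : ℝ) *
    ∫ ω, (1 - W ω) ^ (m - r) * W ω ^ (n - m) ∂P

/-- `W 0, W 1, …` are independent random variables with values in `[0, 1]`, on a probability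
space. -/
structure IsIndepUnitSequence {Ω : Type*} [MeasurableSpace Ω] (P : Measure Ω)
    (W : ℕ → Ω → ℝ) : Prop where
  isProbabilityMeasure : IsProbabilityMeasure P
  measurable : ∀ k, Measurable (W k)
  mem_Icc : ∀ k ω, W k ω ∈ Set.Icc (0 : ℝ) 1
  indep : iIndepFun W P

/-! Under the product form, `q 0 n m` is the probability that the first part of a composition of `n`
is `m`. Paint `ρ 0` balls of the first part black. As far as that part is concerned, constrained
sampling deletes a uniformly chosen white ball, so the numbers `M`, `K` of white balls inside and
outside the first part form an exchangeable array. De Finetti's theorem makes it a mixture of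
binomial laws, and the mixing variable is `W 0` (`IsConsistentDecrement.exists_measure_zero`).

If the first part is exactly `ρ 0`, it has no white ball and sampling passes on to the remaining
parts. Restricting consistency to this event shows that the shifted matrices are again consistent
(`IsConsistentDecrement.tail`), provided the event has positive probability for every number of
remaining balls. These probabilities are the moments of `W 0`; they vanish only if `W 0 = 0` almost
surely, in which case no second part occurs. Induction thus reaches every part that occurs.

The other matrices never influence the law, so they may be replaced by any of the required form
(`HasProductForm.congr`). Conversely, matrices of that form are decrement matrices by the binomial
theorem. Independence costs nothing: only the marginal laws enter, and a product space realises
them. -/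

/-! ### De Finetti's theorem for exchangeable arrays. -/

open Filter Topology in
/-- The ratio of falling factorials is close to the ratio of powers. -/
theorem abs_descFactorial_div_sub_pow_le (j : ℕ) {N K : ℕ} (hN : j < N) (hK : K ≤ N) :
    |(K.descFactorial j : ℝ) / N.descFactorial j - ((K : ℝ) / N) ^ j| ≤
      ∑ i ∈ Finset.range j, (i : ℝ) / ((N : ℝ) - i) := by
  induction j with
  | zero => simp
  | succ j ih =>
    have ih := ih (by omega)
    rw [Finset.sum_range_succ]
    have hNj : (0 : ℝ) < (N : ℝ) - j := by
      rw [sub_pos]; exact_mod_cast (by omega : j < N)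
    have hN0 : (0 : ℝ) < N := by exact_mod_cast (by omega : 0 < N)
    have hKN : (K : ℝ) ≤ N := by exact_mod_cast hK
    have hK0 : (0 : ℝ) ≤ K := by positivity
    set F : ℝ := (K.descFactorial j : ℝ) / N.descFactorial j with hF
    have hD : (0 : ℝ) < N.descFactorial j := by
      exact_mod_cast Nat.descFactorial_pos.2 (by omega)
    have hF0 : 0 ≤ F := by positivity
    have hF1 : F ≤ 1 := by
      rw [hF, div_le_one hD]
      exact_mod_cast Nat.descFactorial_le j hK
    have hstep : (K.descFactorial (j + 1) : ℝ) / N.descFactorial (j + 1) =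
        F * (((K : ℝ) - j) / ((N : ℝ) - j)) := by
      have h1 : ((N - j : ℕ) : ℝ) = (N : ℝ) - j := by
        rw [Nat.cast_sub (by omega)]
      -- For `K < j` the truncated subtraction is harmless, because the falling factorial vanishes.
      have h2 : ((K - j : ℕ) : ℝ) * K.descFactorial j = ((K : ℝ) - j) * K.descFactorial j := by
        rcases le_or_gt j K with h | h
        · rw [Nat.cast_sub h]
        · rw [Nat.descFactorial_of_lt h]; simp
      rw [Nat.descFactorial_succ, Nat.descFactorial_succ, Nat.cast_mul, Nat.cast_mul, h1, h2, hF]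
      field_simp
    have hx1 : (K : ℝ) / N ≤ 1 := (div_le_one hN0).2 hKN
    have hdiff : |((K : ℝ) - j) / ((N : ℝ) - j) - (K : ℝ) / N| ≤ (j : ℝ) / ((N : ℝ) - j) := by
      have h3 : ((K : ℝ) - j) / ((N : ℝ) - j) - (K : ℝ) / N =
          -((j : ℝ) / ((N : ℝ) - j) * (1 - (K : ℝ) / N)) := by
        field_simp; ring
      have h4 : (0 : ℝ) ≤ (j : ℝ) / ((N : ℝ) - j) := by positivity
      have h5 : 0 ≤ 1 - (K : ℝ) / N := by linarith
      rw [h3, abs_neg, abs_of_nonneg (mul_nonneg h4 h5)]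
      have h6 : (0 : ℝ) ≤ (K : ℝ) / N := by positivity
      nlinarith
    rw [hstep, pow_succ]
    calc |F * (((K : ℝ) - j) / ((N : ℝ) - j)) - ((K : ℝ) / N) ^ j * ((K : ℝ) / N)|
        = |F * (((K : ℝ) - j) / ((N : ℝ) - j) - (K : ℝ) / N)
            + (F - ((K : ℝ) / N) ^ j) * ((K : ℝ) / N)| := by congr 1; ring
      _ ≤ |F * (((K : ℝ) - j) / ((N : ℝ) - j) - (K : ℝ) / N)|
            + |(F - ((K : ℝ) / N) ^ j) * ((K : ℝ) / N)| := abs_add_le _ _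
      _ ≤ (j : ℝ) / ((N : ℝ) - j) + |F - ((K : ℝ) / N) ^ j| := by
          rw [abs_mul, abs_mul, abs_of_nonneg hF0,
            abs_of_nonneg (by positivity : (0 : ℝ) ≤ (K : ℝ) / N)]
          gcongr
          · exact (mul_le_of_le_one_left (abs_nonneg _) hF1).trans hdiff
          · exact mul_le_of_le_one_right (abs_nonneg _) hx1
      _ ≤ _ := by linarith

open Filter Topology in
theorem tendsto_sum_div_sub (j : ℕ) :
    Tendsto (fun N : ℕ => ∑ i ∈ Finset.range j, (i : ℝ) / ((N : ℝ) - i)) atTop (𝓝 0) := by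
  have : Tendsto (fun N : ℕ => ∑ i ∈ Finset.range j, (i : ℝ) / ((N : ℝ) - i)) atTop
      (𝓝 (∑ i ∈ Finset.range j, 0)) := by
    refine tendsto_finsetSum _ fun i _ => ?_
    refine Tendsto.div_atTop tendsto_const_nhds ?_
    exact tendsto_atTop_add_const_right _ (-(i : ℝ)) tendsto_natCast_atTop_atTop
  simpa using this

/-- The arrays `g M K = P(M failures, K successes)` of exchangeable sequences of trials: each row
`M + K = N` is a probability distribution, and forgetting one trial at random maps each row to the
previous one. -/
structure IsExchangeableArray (g : ℕ → ℕ → ℝ) : Prop where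
  nonneg : ∀ M K, 0 ≤ g M K
  sum_eq_one : ∀ N, ∑ p ∈ Finset.HasAntidiagonal.antidiagonal N, g p.1 p.2 = 1
  recurrence : ∀ M K, g M K * ((M : ℝ) + K + 1) =
    g (M + 1) K * ((M : ℝ) + 1) + g M (K + 1) * ((K : ℝ) + 1)

namespace IsExchangeableArray

variable {g : ℕ → ℕ → ℝ}

/-- Normalised by the falling factorial of `N`, the `j`-th factorial moment of the number of
successes does not depend on `N ≥ j`; this is one step of that invariance. -/
theorem sum_descFactorial_succ (hg : IsExchangeableArray g) (j N : ℕ) :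
    (∑ p ∈ Finset.HasAntidiagonal.antidiagonal N, g p.1 p.2 * (p.2.descFactorial j : ℝ)) * ((N : ℝ) + 1) =
      (∑ p ∈ Finset.HasAntidiagonal.antidiagonal (N + 1), g p.1 p.2 * (p.2.descFactorial j : ℝ)) *
        ((N : ℝ) + 1 - j) := by
  have key : ∀ K : ℕ, ((K : ℝ) + 1) * (K.descFactorial j : ℝ) =
      ((K : ℝ) + 1 - j) * ((K + 1).descFactorial j : ℝ) := by
    intro K
    rcases le_or_gt j (K + 1) with h | h
    · have h1 := Nat.succ_descFactorial K j
      have h2 : ((K + 1 - j : ℕ) : ℝ) = (K : ℝ) + 1 - j := by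
        rw [Nat.cast_sub h]; push_cast; ring
      rw [← h2]
      exact_mod_cast h1.symm
    · rw [Nat.descFactorial_of_lt h, Nat.descFactorial_of_lt (by omega : K < j)]; simp
  have e1 : ∑ p ∈ Finset.HasAntidiagonal.antidiagonal (N + 1), g p.1 p.2 * ((p.1 : ℝ) * p.2.descFactorial j) =
      ∑ p ∈ Finset.HasAntidiagonal.antidiagonal N,
        g (p.1 + 1) p.2 * (((p.1 : ℝ) + 1) * p.2.descFactorial j) := by
    rw [Finset.Nat.sum_antidiagonal_succ]; simp
  have e2 : ∑ p ∈ Finset.HasAntidiagonal.antidiagonal (N + 1),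
        g p.1 p.2 * (((p.2 : ℝ) - j) * p.2.descFactorial j) =
      ∑ p ∈ Finset.HasAntidiagonal.antidiagonal N,
        g p.1 (p.2 + 1) * (((p.2 : ℝ) + 1 - j) * (p.2 + 1).descFactorial j) := by
    rw [Finset.Nat.sum_antidiagonal_succ']
    -- The boundary term at zero successes contains `-j` times the falling factorial of `0`: one of
    -- the two is zero.
    cases j <;> simp
  have e3 : (∑ p ∈ Finset.HasAntidiagonal.antidiagonal (N + 1), g p.1 p.2 * (p.2.descFactorial j : ℝ)) *
        ((N : ℝ) + 1 - j) =
      ∑ p ∈ Finset.HasAntidiagonal.antidiagonal (N + 1), g p.1 p.2 * ((p.1 : ℝ) * p.2.descFactorial j) +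
      ∑ p ∈ Finset.HasAntidiagonal.antidiagonal (N + 1),
        g p.1 p.2 * (((p.2 : ℝ) - j) * p.2.descFactorial j) := by
    rw [Finset.sum_mul, ← Finset.sum_add_distrib]
    refine Finset.sum_congr rfl fun p hp => ?_
    have : (N : ℝ) + 1 = p.1 + p.2 := by exact_mod_cast (Finset.HasAntidiagonal.mem_antidiagonal.1 hp).symm
    rw [this]; ring
  rw [e3, e1, e2, Finset.sum_mul, ← Finset.sum_add_distrib]
  refine Finset.sum_congr rfl fun p hp => ?_
  have : (N : ℝ) = p.1 + p.2 := by exact_mod_cast (Finset.HasAntidiagonal.mem_antidiagonal.1 hp).symm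
  rw [← key, this]
  linear_combination (p.2.descFactorial j : ℝ) * hg.recurrence p.1 p.2

/-- The invariant moment is evaluated at `N = j`, where only `j` successes out of `j` contribute. -/
theorem sum_descFactorial (hg : IsExchangeableArray g) (j d : ℕ) :
    ∑ p ∈ Finset.HasAntidiagonal.antidiagonal (j + d), g p.1 p.2 * (p.2.descFactorial j : ℝ) =
      g 0 j * (j + d).descFactorial j := by
  induction d with
  | zero =>
    rw [add_zero, Finset.sum_eq_single (0, j)]
    · rintro ⟨M, K⟩ hp hne
      have h1 : M + K = j := Finset.HasAntidiagonal.mem_antidiagonal.1 hp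
      have h2 : K < j := by
        rcases Nat.eq_zero_or_pos M with rfl | h
        · exact absurd (by simp at h1; simp [h1]) hne
        · omega
      simp [Nat.descFactorial_of_lt h2]
    · simp
  | succ d ih =>
    have h := hg.sum_descFactorial_succ j (j + d)
    rw [ih] at h
    have h1 := Nat.succ_descFactorial (j + d) j
    have h2 : j + d + 1 - j = d + 1 := by omega
    rw [h2] at h1
    have h3 : ((d : ℝ) + 1) * ((j + d + 1).descFactorial j : ℝ) =
        ((j : ℝ) + d + 1) * (j + d).descFactorial j := by exact_mod_cast h1
    have h4 : (0 : ℝ) < (d : ℝ) + 1 := by positivity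
    rw [← add_assoc]
    refine mul_right_cancel₀ h4.ne' ?_
    push_cast at h
    linear_combination -h - g 0 j * h3

/-- The proportion of successes. -/
noncomputable def ratio (p : ℕ × ℕ) : unitInterval :=
  ⟨(p.2 : ℝ) / ((p.1 : ℝ) + p.2), by positivity,
    div_le_one_of_le₀ (by simp) (by positivity)⟩

/-- The law of the proportion of successes in `N` trials. -/
noncomputable def ratioLaw (g : ℕ → ℕ → ℝ) (N : ℕ) : Measure unitInterval :=
  ∑ p ∈ Finset.HasAntidiagonal.antidiagonal N, ENNReal.ofReal (g p.1 p.2) • Measure.dirac (ratio p)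

theorem isProbabilityMeasure_ratioLaw (hg : IsExchangeableArray g) (N : ℕ) :
    IsProbabilityMeasure (ratioLaw g N) := by
  constructor
  simp only [ratioLaw, Measure.coe_finsetSum, Finset.sum_apply, Measure.smul_apply, measure_univ,
    smul_eq_mul, mul_one]
  rw [← ENNReal.ofReal_sum_of_nonneg fun p _ => hg.nonneg _ _, hg.sum_eq_one, ENNReal.ofReal_one]

theorem integral_ratioLaw (hg : IsExchangeableArray g) (N : ℕ) (f : unitInterval → ℝ) :
    ∫ x, f x ∂ratioLaw g N = ∑ p ∈ Finset.HasAntidiagonal.antidiagonal N, g p.1 p.2 * f (ratio p) := by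
  rw [ratioLaw, integral_finsetSum_measure]
  · refine Finset.sum_congr rfl fun p _ => ?_
    rw [integral_smul_measure, integral_dirac, ENNReal.toReal_ofReal (hg.nonneg _ _), smul_eq_mul]
  · intro p _
    exact (integrable_dirac (by simp)).smul_measure ENNReal.ofReal_ne_top

-- `g 0 j` is exactly a normalised factorial moment for each large `N`, and replacing falling
-- factorials by powers costs an error that is uniform over the row and tends to `0`.
open Filter Topology in
theorem tendsto_integral_ratioLaw (hg : IsExchangeableArray g) (j : ℕ) :
    Tendsto (fun N => ∫ x, (x : ℝ) ^ j ∂ratioLaw g N) atTop (𝓝 (g 0 j)) := by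
  rw [tendsto_iff_dist_tendsto_zero]
  refine squeeze_zero' (Eventually.of_forall fun _ => dist_nonneg) ?_ (tendsto_sum_div_sub j)
  filter_upwards [eventually_gt_atTop j] with N hN
  obtain ⟨d, rfl⟩ := Nat.exists_eq_add_of_lt hN
  have hD : (0 : ℝ) < (j + d + 1).descFactorial j := by
    exact_mod_cast Nat.descFactorial_pos.2 (by omega)
  have h := hg.sum_descFactorial j (d + 1)
  rw [← add_assoc] at h
  have h' : g 0 j = ∑ p ∈ Finset.HasAntidiagonal.antidiagonal (j + d + 1),
      g p.1 p.2 * ((p.2.descFactorial j : ℝ) / (j + d + 1).descFactorial j) := by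
    rw [← mul_right_cancel_iff_of_pos hD, ← h, Finset.sum_mul]
    refine Finset.sum_congr rfl fun p _ => ?_
    field_simp
  rw [dist_comm, Real.dist_eq, hg.integral_ratioLaw, h', ← Finset.sum_sub_distrib]
  calc |∑ p ∈ Finset.HasAntidiagonal.antidiagonal (j + d + 1),
        (g p.1 p.2 * ((p.2.descFactorial j : ℝ) / (j + d + 1).descFactorial j)
          - g p.1 p.2 * (ratio p : ℝ) ^ j)|
      ≤ ∑ p ∈ Finset.HasAntidiagonal.antidiagonal (j + d + 1), g p.1 p.2 *
          ∑ i ∈ Finset.range j, (i : ℝ) / (((j + d + 1 : ℕ) : ℝ) - i) := by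
        refine (Finset.abs_sum_le_sum_abs _ _).trans (Finset.sum_le_sum fun p hp => ?_)
        have hp := Finset.HasAntidiagonal.mem_antidiagonal.1 hp
        rw [← mul_sub, abs_mul, abs_of_nonneg (hg.nonneg _ _)]
        refine mul_le_mul_of_nonneg_left ?_ (hg.nonneg _ _)
        have hr : (ratio p : ℝ) = (p.2 : ℝ) / ((j + d + 1 : ℕ) : ℝ) := by
          rw [← hp]; simp [ratio]
        rw [hr]
        exact abs_descFactorial_div_sub_pow_le j hN (by omega)
    _ = _ := by rw [← Finset.sum_mul, hg.sum_eq_one, one_mul]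

open Filter Topology in
/-- De Finetti's theorem for exchangeable arrays (Hausdorff moment problem). -/
theorem exists_measure (hg : IsExchangeableArray g) :
    ∃ μ : Measure unitInterval, IsProbabilityMeasure μ ∧ ∀ M K : ℕ,
      g M K = (M + K).choose M * ∫ x, (1 - (x : ℝ)) ^ M * (x : ℝ) ^ K ∂μ := by
  let ν : ℕ → ProbabilityMeasure unitInterval :=
    fun N => ⟨ratioLaw g N, hg.isProbabilityMeasure_ratioLaw N⟩
  -- Probability measures on the compact interval form a compact space, so the laws of the success
  -- ratio converge along an ultrafilter finer than `atTop`.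
  let U : Ultrafilter (ProbabilityMeasure unitInterval) := (hyperfilter ℕ).map ν
  obtain ⟨μ, -, hμ⟩ := isCompact_univ.ultrafilter_le_nhds U (by simp)
  have hlim : Tendsto ν (hyperfilter ℕ : Filter ℕ) (𝓝 μ) := hμ
  rw [ProbabilityMeasure.tendsto_iff_forall_integral_tendsto] at hlim
  have hmom : ∀ j, ∫ x, (x : ℝ) ^ j ∂(μ : Measure unitInterval) = g 0 j := by
    intro j
    let f : BoundedContinuousFunction unitInterval ℝ :=
      BoundedContinuousFunction.mkOfCompact ⟨fun x => (x : ℝ) ^ j, by fun_prop⟩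
    refine tendsto_nhds_unique (hlim f) ?_
    exact (hg.tendsto_integral_ratioLaw j).mono_left Nat.hyperfilter_le_atTop
  refine ⟨μ, inferInstance, fun M => ?_⟩
  have hint : ∀ f : unitInterval → ℝ, Continuous f → Integrable f (μ : Measure unitInterval) :=
    fun f hf => (BoundedContinuousFunction.mkOfCompact ⟨f, hf⟩).integrable _
  -- The moments determine the whole array: the recurrence expresses `g (M + 1) K` through entries
  -- with `M` failures, matching the expansion of one factor `1 - x`.
  induction M with
  | zero => intro K; simp [hmom]
  | succ M ih =>
    intro K
    have hI : ∫ x, (1 - (x : ℝ)) ^ (M + 1) * (x : ℝ) ^ K ∂(μ : Measure unitInterval) =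
        ∫ x, (1 - (x : ℝ)) ^ M * (x : ℝ) ^ K ∂(μ : Measure unitInterval) -
          ∫ x, (1 - (x : ℝ)) ^ M * (x : ℝ) ^ (K + 1) ∂(μ : Measure unitInterval) := by
      rw [← integral_sub (hint _ (by fun_prop)) (hint _ (by fun_prop))]
      congr 1; ext x; ring
    have hr := hg.recurrence M K
    rw [ih K, ih (K + 1)] at hr
    rw [hI]
    have h1 : ((M + 1 + K).choose (M + 1) : ℝ) * ((M : ℝ) + 1) =
        ((M : ℝ) + K + 1) * (M + K).choose M := by
      have := Nat.add_one_mul_choose_eq (M + K) M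
      rw [show M + 1 + K = M + K + 1 by ring]
      exact_mod_cast this.symm
    have h2 : ((M + (K + 1)).choose M : ℝ) * ((K : ℝ) + 1) =
        ((M : ℝ) + K + 1) * (M + K).choose M := by
      have := Nat.choose_mul_succ_eq (M + K) M
      have e : M + K + 1 - M = K + 1 := by omega
      rw [e] at this
      rw [← add_assoc]
      have h3 : ((M + K).choose M : ℝ) * ((M : ℝ) + K + 1) =
        ((M + K + 1).choose M : ℝ) * ((K : ℝ) + 1) := by exact_mod_cast this
      rw [← h3]; ring
    have h4 : (0 : ℝ) < (M : ℝ) + 1 := by positivity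
    refine mul_right_cancel₀ h4.ne' ?_
    set A := ∫ x, (1 - (x : ℝ)) ^ M * (x : ℝ) ^ K ∂(μ : Measure unitInterval)
    set B := ∫ x, (1 - (x : ℝ)) ^ M * (x : ℝ) ^ (K + 1) ∂(μ : Measure unitInterval)
    linear_combination -hr - B * h2 - (A - B) * h1

end IsExchangeableArray

/-! ### Constrained sampling and decrement products on lists. -/

theorem sum_composition_eq_sum_sum_cons {n : ℕ} (hn : 1 ≤ n) (f : List ℕ → ℝ) :
    ∑ c : Composition n, f c.blocks =
      ∑ m ∈ Finset.Icc 1 n, ∑ t : Composition (n - m), f (m :: t.blocks) := by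
  rw [Finset.sum_sigma']
  symm
  refine Finset.sum_bij (fun x hx => ⟨x.1 :: x.2.blocks, ?_, ?_⟩) ?_ ?_ ?_ ?_
  · intro i hi
    have := (Finset.mem_Icc.1 (Finset.mem_sigma.1 hx).1).1
    rcases List.mem_cons.1 hi with rfl | h
    · exact this
    · exact x.2.blocks_pos h
  · have := (Finset.mem_Icc.1 (Finset.mem_sigma.1 hx).1).2
    rw [List.sum_cons, x.2.blocks_sum]; omega
  · intros; simp
  · rintro ⟨m, t⟩ h ⟨m', t'⟩ h' he
    have he' := congrArg Composition.blocks he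
    simp only [List.cons.injEq] at he'
    obtain ⟨rfl, h2⟩ := he'
    rw [Composition.ext h2]
  · intro c _
    obtain ⟨l, hl, hs⟩ := c
    cases l with
    | nil => simp at hs; omega
    | cons m t =>
      have hm : 0 < m := hl (by simp)
      simp only [List.sum_cons] at hs
      refine ⟨⟨m, ⟨t, fun hi => hl (List.mem_cons_of_mem _ hi), by omega⟩⟩, ?_, rfl⟩
      simp; omega
  · intros; rfl

theorem sum_composition_zero (f : List ℕ → ℝ) : ∑ c : Composition 0, f c.blocks = f [] := by
  have h : ∀ c : Composition 0, c.blocks = [] := fun c => by simp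
  have hc : Fintype.card (Composition 0) = 1 := by simp [composition_card]
  simp [h, hc]

theorem sum_composition_blocks_eq {N : ℕ} {l : List ℕ} (hl : ∀ i ∈ l, 0 < i) (hs : l.sum = N)
    (f : List ℕ → ℝ) :
    ∑ t : Composition N, f t.blocks * (if t.blocks = l then 1 else 0) = f l := by
  rw [Finset.sum_eq_single (⟨l, fun {i} hi => hl i hi, hs⟩ : Composition N)]
  · simp
  · intro b _ hb
    have : b.blocks ≠ l := fun h => hb (Composition.ext h)
    simp [this]
  · simp

/-- The probability of the composition `l` when its parts are chosen one after the other according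
to the decrement matrices `q 0, q 1, …`. -/
def decrementProd : (ℕ → ℕ → ℕ → ℝ) → List ℕ → ℝ
  | _, [] => 1
  | q, m :: t => q 0 (m + t.sum) m * decrementProd (fun k => q (k + 1)) t

theorem prod_eq_decrementProd (q : ℕ → ℕ → ℕ → ℝ) (l : List ℕ) :
    ∏ k : Fin l.length, q k (l.drop k).sum (l.get k) = decrementProd q l := by
  induction l generalizing q with
  | nil => simp [decrementProd]
  | cons m t ih =>
    rw [decrementProd, ← ih]
    simp only [List.length_cons]
    rw [Fin.prod_univ_succ]
    simp

/-- The list version of `IsConstrained`. -/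
def IsConstrainedList (ρ : ℕ → ℕ) (l : List ℕ) : Prop :=
  ∀ (i : ℕ) (h : i + 1 < l.length), ρ i ≤ l[i]

theorem isConstrainedList_cons {ρ : ℕ → ℕ} {m : ℕ} {t : List ℕ} (ht : t ≠ []) :
    IsConstrainedList ρ (m :: t) ↔ ρ 0 ≤ m ∧ IsConstrainedList (fun k => ρ (k + 1)) t := by
  have hl := List.length_pos_iff.2 ht
  constructor
  · intro h
    refine ⟨h 0 (by simpa using hl), fun i hi => ?_⟩
    exact h (i + 1) (by simpa using hi)
  · rintro ⟨h0, h1⟩ i hi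
    cases i with
    | zero => exact h0
    | succ i => exact h1 i (by simpa using hi)

theorem samplingProb_succ (ρ : ℕ → ℕ) (k : ℕ) (l t : List ℕ) :
    samplingProb ρ (k + 1) l t = samplingProb (fun i => ρ (i + 1)) k l t := by
  induction l generalizing k t with
  | nil => simp [samplingProb]
  | cons m l ih =>
    cases l with
    | nil => simp [samplingProb]
    | cons m' l =>
      cases t with
      | nil => simp [samplingProb]
      | cons h t => simp [samplingProb, ih]

/-- One step of constrained sampling from a composition with at least two parts. -/
theorem samplingProb_cons {ρ : ℕ → ℕ} {l : List ℕ} (hl : l ≠ []) (m h : ℕ) (t : List ℕ) :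
    samplingProb ρ 0 (m :: l) (h :: t) =
      ((m : ℝ) - ρ 0) / ((m : ℝ) + l.sum - ρ 0) * (if h = m - 1 ∧ t = l then 1 else 0) +
        (l.sum : ℝ) / ((m : ℝ) + l.sum - ρ 0) *
          (if h = m then samplingProb (fun i => ρ (i + 1)) 0 l t else 0) := by
  cases l with
  | nil => exact absurd rfl hl
  | cons m' l => simp only [samplingProb, samplingProb_succ, List.cons.injEq]

theorem samplingProb_singleton {ρ : ℕ → ℕ} {n : ℕ} (hn : 1 ≤ n) (t : List ℕ) :
    samplingProb ρ 0 [n + 1] t = if t = [n] then 1 else 0 := by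
  have : n ≠ 0 := by omega
  simp [samplingProb, this]

/-- The law of the first part under constrained sampling, given that the sampling of the remaining
parts is stochastic. -/
theorem sum_samplingProb_cons {ρ : ℕ → ℕ} {n m m' : ℕ} {t' : List ℕ}
    (hm : 1 ≤ m) (hmn : m ≤ n) (hpos : ∀ i ∈ t', 0 < i) (hsum : m' + t'.sum = n + 1)
    (hρn : ρ 0 < n + 1)
    (hS : t' ≠ [] → ∀ N, t'.sum = N + 1 →
      ∑ t : Composition N, samplingProb (fun i => ρ (i + 1)) 0 t' t.blocks = 1) :
    ∑ t : Composition (n - m), samplingProb ρ 0 (m' :: t') (m :: t.blocks) =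
      ((m' : ℝ) - ρ 0) / ((n : ℝ) + 1 - ρ 0) * (if m' = m + 1 then 1 else 0) +
        ((n : ℝ) + 1 - m') / ((n : ℝ) + 1 - ρ 0) * (if m' = m then 1 else 0) := by
  have hden : (n : ℝ) + 1 - ρ 0 ≠ 0 := by
    have : (ρ 0 : ℝ) < n + 1 := by exact_mod_cast hρn
    linarith
  -- The sure deletion from a single box fits the general formula: with `m' = n + 1` the first
  -- coefficient is `1` and the second is `0`.
  by_cases ht : t' = []
  · subst ht
    obtain rfl : m' = n + 1 := by simpa using hsum
    have h1 : n + 1 ≠ m := by omega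
    have hone : ((n + 1 : ℕ) : ℝ) - ρ 0 = (n : ℝ) + 1 - ρ 0 := by push_cast; ring
    simp only [samplingProb_singleton (hm.trans hmn), List.cons.injEq, h1, if_false, mul_zero,
      add_zero, hone, div_self hden, one_mul, Nat.add_right_cancel_iff]
    by_cases h2 : m = n
    · subst h2
      have e := sum_composition_blocks_eq (N := m - m) (l := []) (by simp) (by simp) fun _ => 1
      simpa using e
    · simp [h2, Ne.symm h2]
  · have hs : ((t'.sum : ℕ) : ℝ) = (n : ℝ) + 1 - m' := by
      have : (m' : ℝ) + t'.sum = n + 1 := by exact_mod_cast hsum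
      linarith
    have hd : (m' : ℝ) + t'.sum - ρ 0 = (n : ℝ) + 1 - ρ 0 := by rw [hs]; ring
    simp only [samplingProb_cons ht, hd]
    rw [Finset.sum_add_distrib, ← Finset.mul_sum, ← Finset.mul_sum, hs]
    congr 2
    · by_cases h : m' = m + 1
      · subst h
        have e := sum_composition_blocks_eq (N := n - m) hpos (by omega) fun _ => 1
        simpa using e
      · have : ¬ m = m' - 1 := by omega
        simp [h, this]
    · by_cases h : m' = m
      · subst h
        have := hS ht (n - m') (by omega)
        simpa using this
      · simp [h, Ne.symm h]

/-- Constrained sampling turns a constrained composition into a composition. -/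
theorem sum_samplingProb {l : List ℕ} {ρ : ℕ → ℕ} (hρ : ∀ k, 1 ≤ ρ k) (hpos : ∀ i ∈ l, 0 < i)
    (hl : IsConstrainedList ρ l) {n : ℕ} (hsum : l.sum = n + 1) :
    ∑ t : Composition n, samplingProb ρ 0 l t.blocks = 1 := by
  induction l generalizing ρ n with
  | nil => simp at hsum
  | cons m' t' ih =>
    have hpos' : ∀ i ∈ t', 0 < i := fun i hi => hpos i (List.mem_cons_of_mem _ hi)
    simp only [List.sum_cons] at hsum
    by_cases ht : t' = []
    · subst ht
      obtain rfl : m' = n + 1 := by simpa using hsum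
      have e := sum_composition_blocks_eq (N := n) (l := if n = 0 then [] else [n])
        (by split_ifs <;> simp; omega) (by split_ifs with h <;> simp [h]) fun _ => 1
      simpa [samplingProb] using e
    · obtain ⟨hm', hl'⟩ := (isConstrainedList_cons ht).1 hl
      have htpos : 0 < t'.sum := by
        obtain ⟨a, u, rfl⟩ := List.exists_cons_of_ne_nil ht
        have := hpos' a (by simp)
        simp; omega
      have h0 := hρ 0
      have hlt : (ρ 0 : ℝ) < n + 1 := by exact_mod_cast (by omega : ρ 0 < n + 1)
      rw [sum_composition_eq_sum_sum_cons (by omega)]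
      rw [Finset.sum_congr rfl fun m hm => sum_samplingProb_cons (Finset.mem_Icc.1 hm).1
        (Finset.mem_Icc.1 hm).2 hpos' hsum (by omega) fun _ N hN =>
          ih (fun k => hρ (k + 1)) hpos' hl' hN]
      rw [Finset.sum_add_distrib, ← Finset.mul_sum, ← Finset.mul_sum]
      have h2 : ∑ m ∈ Finset.Icc 1 n, (if m' = m then (1 : ℝ) else 0) = 1 := by
        rw [Finset.sum_ite_eq, if_pos]; simp; omega
      -- If `m' = ρ 0` the factor vanishes, whether or not `m' - 1` is in the range; otherwise `m' -
      -- 1 ≥ ρ 0 ≥ 1` is.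
      have h3 : ((m' : ℝ) - ρ 0) *
          ∑ m ∈ Finset.Icc 1 n, (if m' = m + 1 then (1 : ℝ) else 0) = (m' : ℝ) - ρ 0 := by
        rcases hm'.eq_or_lt with h | h
        · simp [h]
        · rw [Finset.sum_eq_single (m' - 1)]
          · rw [if_pos (by omega), mul_one]
          · intro b _ hb; rw [if_neg (by omega)]
          · intro hb; simp at hb; omega
      rw [h2, div_mul_eq_mul_div, h3, mul_one, ← add_div, div_eq_one_iff_eq (by linarith)]
      ring

theorem sum_decrementProd {q : ℕ → ℕ → ℕ → ℝ} (hq : ∀ k, IsDecrementMatrix (q k)) (n : ℕ) :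
    ∑ c : Composition n, decrementProd q c.blocks = 1 := by
  induction n using Nat.strong_induction_on generalizing q with
  | _ n ih =>
    rcases Nat.eq_zero_or_pos n with rfl | hn
    · rw [sum_composition_zero]; rfl
    · rw [sum_composition_eq_sum_sum_cons hn, ← (hq 0).sum_eq_one n hn]
      refine Finset.sum_congr rfl fun m hm => ?_
      have hm := Finset.mem_Icc.1 hm
      have e : m + (n - m) = n := by omega
      simp only [decrementProd, Composition.blocks_sum, e]
      rw [← Finset.mul_sum, ih (n - m) (by omega) fun k => hq (k + 1), mul_one]

theorem sum_decrementProd_cons {q : ℕ → ℕ → ℕ → ℝ} (hq : ∀ k, IsDecrementMatrix (q k)) {n m : ℕ}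
    (hmn : m ≤ n) : ∑ t : Composition (n - m), decrementProd q (m :: t.blocks) = q 0 n m := by
  have e : m + (n - m) = n := by omega
  simp only [decrementProd, Composition.blocks_sum, e]
  rw [← Finset.mul_sum, sum_decrementProd fun k => hq (k + 1), mul_one]

/-! ### The law of the first part. -/

/-- The decrement matrices `q` generate a family of distributions of constrained compositions
which is consistent with respect to constrained sampling. -/
structure IsConsistentDecrement (ρ : ℕ → ℕ) (q : ℕ → ℕ → ℕ → ℝ) : Prop where
  one_le : ∀ k, 1 ≤ ρ k
  decrement : ∀ k, IsDecrementMatrix (q k)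
  eq_zero : ∀ l : List ℕ, (∀ i ∈ l, 0 < i) → ¬ IsConstrainedList ρ l → decrementProd q l = 0
  consistent : ∀ n : ℕ, 1 ≤ n → ∀ c : Composition n, decrementProd q c.blocks =
    ∑ d : Composition (n + 1), decrementProd q d.blocks * samplingProb ρ 0 d.blocks c.blocks

namespace IsConsistentDecrement

variable {ρ : ℕ → ℕ} {q : ℕ → ℕ → ℕ → ℝ}

/-- The entry is the total mass of compositions that start with `m` and go on, and none of these is
constrained. -/
theorem eq_zero_of_lt (h : IsConsistentDecrement ρ q) {n m : ℕ} (hm : 1 ≤ m) (hmρ : m < ρ 0)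
    (hmn : m < n) : q 0 n m = 0 := by
  rw [← sum_decrementProd_cons h.decrement hmn.le]
  refine Finset.sum_eq_zero fun t _ => h.eq_zero _ ?_ ?_
  · intro i hi
    rcases List.mem_cons.1 hi with rfl | hi
    · exact hm
    · exact t.blocks_pos hi
  · have ht : t.blocks ≠ [] := by simp; omega
    rw [isConstrainedList_cons ht]
    omega

/-- Consistency is summed over everything after the first part. This closes up because, by
`sum_samplingProb_cons`, the law of the sampled first part depends on the old composition only
through its first part. -/
theorem recurrence (h : IsConsistentDecrement ρ q) {n m : ℕ} (hm : ρ 0 ≤ m) (hmn : m ≤ n) :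
    q 0 n m * ((n : ℝ) + 1 - ρ 0) =
      q 0 (n + 1) (m + 1) * ((m : ℝ) + 1 - ρ 0) + q 0 (n + 1) m * ((n : ℝ) + 1 - m) := by
  have h0 := h.one_le 0
  have hlt : (ρ 0 : ℝ) < n + 1 := by exact_mod_cast (by omega : ρ 0 < n + 1)
  have hden : (n : ℝ) + 1 - ρ 0 ≠ 0 := by linarith
  have key : q 0 n m = ∑ m' ∈ Finset.Icc 1 (n + 1), q 0 (n + 1) m' *
      (((m' : ℝ) - ρ 0) / ((n : ℝ) + 1 - ρ 0) * (if m' = m + 1 then 1 else 0) +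
        ((n : ℝ) + 1 - m') / ((n : ℝ) + 1 - ρ 0) * (if m' = m then 1 else 0)) := by
    rw [← sum_decrementProd_cons h.decrement hmn]
    have hcons : ∀ t : Composition (n - m), decrementProd q (m :: t.blocks) =
        ∑ d : Composition (n + 1),
          decrementProd q d.blocks * samplingProb ρ 0 d.blocks (m :: t.blocks) := by
      intro t
      refine h.consistent n (by omega) ⟨m :: t.blocks, ?_, ?_⟩
      · intro i hi
        rcases List.mem_cons.1 hi with rfl | hi
        · omega
        · exact t.blocks_pos hi
      · rw [List.sum_cons, t.blocks_sum]; omega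
    rw [Finset.sum_congr rfl fun t _ => hcons t, Finset.sum_comm]
    simp only [← Finset.mul_sum]
    rw [sum_composition_eq_sum_sum_cons (n := n + 1) (by omega) fun d => decrementProd q d *
      ∑ t : Composition (n - m), samplingProb ρ 0 d (m :: t.blocks)]
    refine Finset.sum_congr rfl fun m' hm' => ?_
    have hm' := Finset.mem_Icc.1 hm'
    rw [← sum_decrementProd_cons h.decrement hm'.2, Finset.sum_mul]
    refine Finset.sum_congr rfl fun t' _ => ?_
    -- Sampling is known to be stochastic only from constrained lists; the others carry no mass.
    by_cases hd : IsConstrainedList ρ (m' :: t'.blocks)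
    · rw [sum_samplingProb_cons (by omega) hmn (fun i hi => t'.blocks_pos hi)
        (by rw [t'.blocks_sum]; omega) (by omega)]
      intro ht N hN
      exact sum_samplingProb (fun k => h.one_le (k + 1)) (fun i hi => t'.blocks_pos hi)
        ((isConstrainedList_cons ht).1 hd).2 hN
    · rw [h.eq_zero _ _ hd]
      · simp
      · intro i hi
        rcases List.mem_cons.1 hi with rfl | hi
        · omega
        · exact t'.blocks_pos hi
  rw [key]
  simp only [mul_add, Finset.sum_add_distrib, mul_ite, mul_one, mul_zero, Finset.sum_ite_eq']
  rw [if_pos (by simp; omega), if_pos (by simp; omega)]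
  push_cast
  field_simp

/-- Counting white balls only, with `m = ρ 0 + M` and `n = ρ 0 + M + K`, turns the coefficients of
`recurrence` into `M + K + 1`, `M + 1` and `K + 1`. -/
theorem isExchangeableArray (h : IsConsistentDecrement ρ q) :
    IsExchangeableArray fun M K => q 0 (ρ 0 + M + K) (ρ 0 + M) := by
  have h0 := h.one_le 0
  refine ⟨fun M K => (h.decrement 0).nonneg _ _ (by omega) (by omega), fun N => ?_, fun M K => ?_⟩
  · rw [Finset.Nat.sum_antidiagonal_eq_sum_range_succ
      fun M K => q 0 (ρ 0 + M + K) (ρ 0 + M), ← (h.decrement 0).sum_eq_one (ρ 0 + N) (by omega)]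
    have hsub : Finset.Ico (ρ 0) (ρ 0 + N + 1) ⊆ Finset.Icc 1 (ρ 0 + N) := by
      intro i; simp; omega
    rw [← Finset.sum_subset hsub, Finset.sum_Ico_eq_sum_range]
    · have e : ρ 0 + N + 1 - ρ 0 = N.succ := by omega
      rw [e]
      refine Finset.sum_congr rfl fun i hi => ?_
      have := Finset.mem_range.1 hi
      congr 1; omega
    · intro m hm hm'
      simp only [Finset.mem_Icc, Finset.mem_Ico, not_and, not_lt] at hm hm'
      exact h.eq_zero_of_lt hm.1 (by omega) (by omega)
  · have := h.recurrence (n := ρ 0 + M + K) (m := ρ 0 + M) (by omega) (by omega)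
    push_cast at this
    simp only [← add_assoc]
    rw [show ρ 0 + M + 1 + K = ρ 0 + M + K + 1 by ring]
    linear_combination this

end IsConsistentDecrement

/-! ### Entries of residual matrices. -/

section residualMatrix

variable {Ω : Type*} [MeasurableSpace Ω] (P : Measure Ω) (W : Ω → ℝ)

theorem residualMatrix_add_add (r M K : ℕ) :
    residualMatrix r P W (r + M + K) (r + M) =
      (M + K).choose M * ∫ ω, (1 - W ω) ^ M * W ω ^ K ∂P := by
  have h1 : ((r + M + K : ℕ) : ℤ) - r = Int.ofNat (M + K) := by simp; ring
  have h2 : ((r + M : ℕ) : ℤ) - r = Int.ofNat M := by simp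
  have h3 : r + M + K - (r + M) = K := by omega
  have h4 : r + M - r = M := by omega
  rw [residualMatrix, h1, h2, h3, h4, extChoose]

theorem residualMatrix_eq_zero_of_lt {r n m : ℕ} (hm : m < r) (hmn : m < n) :
    residualMatrix r P W n m = 0 := by
  obtain ⟨b, hb⟩ := Nat.exists_eq_add_of_lt hm
  have h2 : (m : ℤ) - r = Int.negSucc b := by rw [hb, Int.negSucc_eq]; push_cast; ring
  rw [residualMatrix, h2]
  rcases le_or_gt r n with hn | hn
  · obtain ⟨a, rfl⟩ := Nat.exists_eq_add_of_le hn
    have h1 : ((r + a : ℕ) : ℤ) - r = Int.ofNat a := by simp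
    rw [h1, extChoose]; simp
  · obtain ⟨a, ha⟩ := Nat.exists_eq_add_of_lt hn
    have h1 : (n : ℤ) - r = Int.negSucc a := by rw [ha, Int.negSucc_eq]; push_cast; ring
    rw [h1, extChoose, if_neg (by omega)]; simp

theorem residualMatrix_self_of_lt [IsProbabilityMeasure P] {r n : ℕ} (hn : n < r) :
    residualMatrix r P W n n = 1 := by
  obtain ⟨a, ha⟩ := Nat.exists_eq_add_of_lt hn
  have h1 : (n : ℤ) - r = Int.negSucc a := by rw [ha, Int.negSucc_eq]; push_cast; ring
  have h2 : n - r = 0 := by omega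
  rw [residualMatrix, h1, extChoose, h2]; simp

end residualMatrix

/-! ### Mixing measures, part by part. -/

namespace IsConsistentDecrement

variable {ρ : ℕ → ℕ} {q : ℕ → ℕ → ℕ → ℝ}

/-- De Finetti's theorem covers `m ≥ ρ 0`. Entries with `m < ρ 0` vanish off the diagonal, so a row
with `n < ρ 0` is the unit mass at `n`, as the binomial convention prescribes. -/
theorem exists_measure_zero (h : IsConsistentDecrement ρ q) :
    ∃ μ : Measure unitInterval, IsProbabilityMeasure μ ∧ ∀ n m : ℕ, 1 ≤ m → m ≤ n →
      q 0 n m = residualMatrix (ρ 0) μ Subtype.val n m := by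
  obtain ⟨μ, hμ, hg⟩ := h.isExchangeableArray.exists_measure
  refine ⟨μ, hμ, fun n m hm hmn => ?_⟩
  rcases le_or_gt (ρ 0) m with hρm | hρm
  · obtain ⟨M, rfl⟩ := Nat.exists_eq_add_of_le hρm
    obtain ⟨K, rfl⟩ := Nat.exists_eq_add_of_le hmn
    rw [residualMatrix_add_add, hg]
  · rcases hmn.eq_or_lt with rfl | hlt
    · rw [residualMatrix_self_of_lt _ _ hρm, ← (h.decrement 0).sum_eq_one m hm]
      symm
      refine Finset.sum_eq_single_of_mem m (by simp; omega) fun b hb hne => ?_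
      have := Finset.mem_Icc.1 hb
      exact h.eq_zero_of_lt this.1 (by omega) (by omega)
    · rw [residualMatrix_eq_zero_of_lt _ _ hρm hlt, h.eq_zero_of_lt hm hρm hlt]

/-- If some part is followed by another one with positive probability, then so is the first part
whatever the number of remaining balls. -/
theorem pos_of_ne_zero (h : IsConsistentDecrement ρ q) {n m : ℕ} (hm : 1 ≤ m) (hmn : m < n)
    (hq : q 0 n m ≠ 0) (r : ℕ) : 0 < q 0 (ρ 0 + r) (ρ 0) := by
  obtain ⟨μ, hμ, hf⟩ := h.exists_measure_zero
  have h0 := h.one_le 0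
  have hint : Integrable (fun x : unitInterval => (x : ℝ) ^ r) μ :=
    (BoundedContinuousFunction.mkOfCompact
      ⟨fun x : unitInterval => (x : ℝ) ^ r, by fun_prop⟩).integrable _
  refine lt_of_le_of_ne ((h.decrement 0).nonneg _ _ h0 (by omega)) fun hz => hq ?_
  -- The entry in question is the `r`-th moment of `μ`. If it is zero, then `x = 0` almost surely,
  -- and the factor `x ^ (n - m)` with `m < n` kills `q 0 n m`.
  have hr := residualMatrix_add_add μ Subtype.val (ρ 0) 0 r
  simp only [add_zero] at hr
  rw [hf _ _ h0 (by omega), hr] at hz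
  simp only [zero_add, Nat.choose_zero_right, Nat.cast_one, pow_zero, one_mul] at hz
  have hae := (integral_eq_zero_iff_of_nonneg (fun x => pow_nonneg x.2.1 r) hint).1 hz.symm
  rw [hf _ _ hm hmn.le, residualMatrix, integral_eq_zero_of_ae, mul_zero]
  filter_upwards [hae] with x hx
  have hx0 : (x : ℝ) = 0 := eq_zero_of_pow_eq_zero hx
  rw [hx0, zero_pow (by omega), mul_zero]; rfl

/-- Consistency at `ρ 0 :: t` involves two kinds of predecessors: `(ρ 0 + 1) :: t`, with probability
`1 / (r + 1)`, and `ρ 0 :: t'` with `t'` sampled to `t`, where the first box is passed surely.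
Subtracting `recurrence` at `m = ρ 0` cancels the first kind and leaves consistency of the tail,
multiplied by `q 0 (ρ 0 + r + 1) (ρ 0) > 0`. -/
theorem tail (h : IsConsistentDecrement ρ q) (hpos : ∀ r, 0 < q 0 (ρ 0 + r) (ρ 0)) :
    IsConsistentDecrement (fun k => ρ (k + 1)) (fun k => q (k + 1)) where
  one_le k := h.one_le (k + 1)
  decrement k := h.decrement (k + 1)
  eq_zero l hl hc := by
    have hne : l ≠ [] := by
      rintro rfl
      exact hc fun i hi => by simp at hi
    have h1 := h.eq_zero (ρ 0 :: l) (by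
      intro i hi
      rcases List.mem_cons.1 hi with rfl | hi
      · exact h.one_le 0
      · exact hl i hi) (fun h' => hc ((isConstrainedList_cons hne).1 h').2)
    rw [decrementProd] at h1
    exact (mul_eq_zero.1 h1).resolve_left (hpos _).ne'
  consistent r hr t := by
    have h0 := h.one_le 0
    have ht : t.blocks ≠ [] := by simp; omega
    have hcons := h.consistent (ρ 0 + r) (by omega) ⟨ρ 0 :: t.blocks, by
      intro i hi
      rcases List.mem_cons.1 hi with rfl | hi
      · exact h0
      · exact t.blocks_pos hi, by simp⟩
    simp only at hcons
    set p' := decrementProd fun k => q (k + 1) with hp'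
    have hsum : ∑ d : Composition (ρ 0 + r + 1),
        decrementProd q d.blocks * samplingProb ρ 0 d.blocks (ρ 0 :: t.blocks) =
        q 0 (ρ 0 + r + 1) (ρ 0 + 1) * p' t.blocks / ((r : ℝ) + 1) +
        q 0 (ρ 0 + r + 1) (ρ 0) * ∑ d : Composition (r + 1), p' d.blocks *
          samplingProb (fun k => ρ (k + 1)) 0 d.blocks t.blocks := by
      have hr1 : (r : ℝ) + 1 ≠ 0 := by positivity
      have hstep : ∀ m' ∈ Finset.Icc 1 (ρ 0 + r + 1),
          ∑ t' : Composition (ρ 0 + r + 1 - m'), decrementProd q (m' :: t'.blocks) *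
            samplingProb ρ 0 (m' :: t'.blocks) (ρ 0 :: t.blocks) =
          (if m' = ρ 0 + 1 then q 0 (ρ 0 + r + 1) m' / ((r : ℝ) + 1) *
            ∑ t' : Composition (ρ 0 + r + 1 - m'),
              p' t'.blocks * (if t'.blocks = t.blocks then 1 else 0) else 0) +
          (if m' = ρ 0 then q 0 (ρ 0 + r + 1) m' * ∑ t' : Composition (ρ 0 + r + 1 - m'),
            p' t'.blocks * samplingProb (fun k => ρ (k + 1)) 0 t'.blocks t.blocks else 0) := by
        intro m' hm'
        have hm' := Finset.mem_Icc.1 hm'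
        have hs : ∀ t' : Composition (ρ 0 + r + 1 - m'),
            samplingProb ρ 0 (m' :: t'.blocks) (ρ 0 :: t.blocks) =
            (if m' = ρ 0 + 1 then (if t'.blocks = t.blocks then 1 else 0) / ((r : ℝ) + 1) else 0)
            + (if m' = ρ 0 then samplingProb (fun k => ρ (k + 1)) 0 t'.blocks t.blocks
                else 0) := by
          intro t'
          -- A single box cannot lead to `ρ 0 :: t`, since `t` is nonempty; as `r ≥ 1`, both
          -- indicators on the right vanish too.
          by_cases ht' : t'.blocks = []
          · have : ρ 0 + r + 1 - m' = 0 := (Composition.blocks_eq_nil t').1 ht'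
            obtain rfl : m' = ρ 0 + r + 1 := by omega
            rw [ht', samplingProb_singleton (by omega)]
            have h1 : ¬ (ρ 0 + r + 1 = ρ 0 + 1) := by omega
            have h2 : ¬ (ρ 0 + r + 1 = ρ 0) := by omega
            simp [ht, h2]
          · have hden : (m' : ℝ) + t'.blocks.sum - ρ 0 = (r : ℝ) + 1 := by
              have : m' + t'.blocks.sum = ρ 0 + r + 1 := by rw [t'.blocks_sum]; omega
              have : (m' : ℝ) + t'.blocks.sum = ρ 0 + r + 1 := by exact_mod_cast this
              linarith
            rw [samplingProb_cons ht', hden]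
            congr 1
            · by_cases h1 : m' = ρ 0 + 1
              · subst h1
                simp [eq_comm, div_eq_inv_mul]
              · have : ¬ (ρ 0 = m' - 1) := by omega
                simp [h1, this]
            · by_cases h1 : m' = ρ 0
              · rw [if_pos h1.symm, if_pos h1]
                have : (t'.blocks.sum : ℝ) = (r : ℝ) + 1 := by
                  have : (m' : ℝ) = ρ 0 := by exact_mod_cast h1
                  linarith
                rw [this, div_self hr1, one_mul]
              · rw [if_neg (Ne.symm h1), if_neg h1, mul_zero]
        have hd : ∀ t' : Composition (ρ 0 + r + 1 - m'), decrementProd q (m' :: t'.blocks) =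
            q 0 (ρ 0 + r + 1) m' * p' t'.blocks := by
          intro t'
          rw [decrementProd, t'.blocks_sum, show m' + (ρ 0 + r + 1 - m') = ρ 0 + r + 1 by omega]
        simp only [hs, hd, mul_add, Finset.sum_add_distrib]
        congr 1
        · split_ifs with h1
          · rw [Finset.mul_sum]
            exact Finset.sum_congr rfl fun _ _ => by ring
          · simp
        · split_ifs with h1
          · rw [Finset.mul_sum]
            exact Finset.sum_congr rfl fun _ _ => by ring
          · simp
      rw [sum_composition_eq_sum_sum_cons (by omega) fun d =>
        decrementProd q d * samplingProb ρ 0 d (ρ 0 :: t.blocks), Finset.sum_congr rfl hstep,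
        Finset.sum_add_distrib, Finset.sum_ite_eq', Finset.sum_ite_eq', if_pos (by simp),
        if_pos (by simp; omega), show ρ 0 + r + 1 - (ρ 0 + 1) = r by omega,
        show ρ 0 + r + 1 - ρ 0 = r + 1 by omega,
        sum_composition_blocks_eq (fun i hi => t.blocks_pos hi) t.blocks_sum]
      ring
    rw [hsum, decrementProd, t.blocks_sum] at hcons
    have hrec := h.recurrence (n := ρ 0 + r) (m := ρ 0) le_rfl (by omega)
    have hc := hpos (r + 1)
    rw [← add_assoc] at hc
    refine mul_left_cancel₀ hc.ne' ?_
    have hr1 : (r : ℝ) + 1 ≠ 0 := by positivity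
    push_cast at hrec
    field_simp at hcons
    refine mul_left_cancel₀ hr1 ?_
    linear_combination hcons - p' t.blocks * hrec

/-- The first part is peeled off `k` times. The list `l` of nonzero weight certifies at each stage
that the first part can be followed by another, which is what `tail` needs through `pos_of_ne_zero`.
-/
theorem exists_measure (h : IsConsistentDecrement ρ q) {k : ℕ} {l : List ℕ}
    (hl : ∀ i ∈ l, 0 < i) (hk : k < l.length) (hne : decrementProd q l ≠ 0) :
    ∃ μ : Measure unitInterval, IsProbabilityMeasure μ ∧ ∀ n m : ℕ, 1 ≤ m → m ≤ n →
      q k n m = residualMatrix (ρ k) μ Subtype.val n m := by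
  induction k generalizing ρ q l with
  | zero => exact h.exists_measure_zero
  | succ k ih =>
    cases l with
    | nil => simp at hk
    | cons m t =>
      rw [decrementProd] at hne
      have ht : ∀ i ∈ t, 0 < i := fun i hi => hl i (List.mem_cons_of_mem _ hi)
      have hkt : k < t.length := by simpa using hk
      have htpos : 0 < t.sum := by
        obtain ⟨a, u, rfl⟩ := List.exists_cons_of_length_pos (by omega : 0 < t.length)
        have := ht a (by simp)
        simp; omega
      exact ih (h.tail (h.pos_of_ne_zero (hl m (by simp)) (by omega) (left_ne_zero_of_mul hne)))
        ht hkt (right_ne_zero_of_mul hne)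

end IsConsistentDecrement

/-! ### From random compositions to decrement matrices. -/

theorem prod_composition_eq_decrementProd (q : ℕ → ℕ → ℕ → ℝ) {n : ℕ} (c : Composition n) :
    ∏ k : Fin c.length, q k (c.blocks.drop k).sum (c.blocksFun k) = decrementProd q c.blocks :=
  prod_eq_decrementProd q c.blocks

section

variable {ρ : ℕ → ℕ} {Ω : Type*} [MeasurableSpace Ω] {P : Measure Ω}
  {C : ∀ n : ℕ, Ω → Composition n} {q : ℕ → ℕ → ℕ → ℝ}

theorem IsConstrainedCompositionStructure.measureReal_eq_zero
    (hC : IsConstrainedCompositionStructure ρ P C) {n : ℕ} {c : Composition n}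
    (hc : ¬ IsConstrained ρ c) : P.real {ω | C n ω = c} = 0 := by
  rw [measureReal_def, measure_eq_zero_iff_ae_notMem.2, ENNReal.toReal_zero]
  filter_upwards [hC.constrained n] with ω hω h
  exact hc (h ▸ hω)

variable [IsProbabilityMeasure P]

theorem IsConstrainedCompositionStructure.sum_measureReal
    (hC : IsConstrainedCompositionStructure ρ P C) (n : ℕ) :
    ∑ c : Composition n, P.real {ω | C n ω = c} = 1 := by
  have h := sum_measureReal_preimage_singleton (μ := P) (f := C n) Finset.univ
    (fun c _ => hC.measurable n c)
  rw [Finset.coe_univ, Set.preimage_univ, probReal_univ] at h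
  exact h

/-- The product form extends to compositions that are not constrained: both sides vanish. -/
theorem HasProductForm.measureReal_eq (hC : IsConstrainedCompositionStructure ρ P C)
    (hq : ∀ k, IsDecrementMatrix (q k)) (hP : HasProductForm ρ P C q) {n : ℕ} (hn : 1 ≤ n)
    (c : Composition n) : P.real {ω | C n ω = c} = decrementProd q c.blocks := by
  have hpos : ∀ (l : List ℕ) (q : ℕ → ℕ → ℕ → ℝ), (∀ k, IsDecrementMatrix (q k)) →
      (∀ i ∈ l, 0 < i) → 0 ≤ decrementProd q l := by
    intro l
    induction l with
    | nil => intros; simp [decrementProd]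
    | cons m t ih =>
      intro q hq hl
      exact mul_nonneg ((hq 0).nonneg _ _ (hl m (by simp)) (by omega))
        (ih _ (fun k => hq (k + 1)) fun i hi => hl i (List.mem_cons_of_mem _ hi))
  have hle : ∀ d ∈ (Finset.univ : Finset (Composition n)),
      P.real {ω | C n ω = d} ≤ decrementProd q d.blocks := by
    intro d _
    by_cases hd : IsConstrained ρ d
    · rw [hP n hn d hd, prod_composition_eq_decrementProd]
    · rw [hC.measureReal_eq_zero hd]
      exact hpos _ _ hq fun i hi => d.blocks_pos hi
  -- Termwise inequality between two families that both sum to `1` forces equality.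
  refine (Finset.sum_eq_sum_iff_of_le hle).1 ?_ c (Finset.mem_univ c)
  rw [hC.sum_measureReal, sum_decrementProd hq]

theorem HasProductForm.isConsistentDecrement (hρ : ∀ k, 1 ≤ ρ k)
    (hC : IsConstrainedCompositionStructure ρ P C)
    (hq : ∀ k, IsDecrementMatrix (q k)) (hP : HasProductForm ρ P C q) :
    IsConsistentDecrement ρ q where
  one_le := hρ
  decrement := hq
  eq_zero l hl hc := by
    have hne : l ≠ [] := by
      rintro rfl
      exact hc fun i hi => by simp at hi
    have hs : 1 ≤ l.sum := by
      obtain ⟨a, u, rfl⟩ := List.exists_cons_of_ne_nil hne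
      have := hl a (by simp)
      simp; omega
    have h := hP.measureReal_eq hC hq hs ⟨l, fun {i} hi => hl i hi, rfl⟩
    rw [← h]
    exact hC.measureReal_eq_zero hc
  consistent n hn c := by
    rw [← hP.measureReal_eq hC hq hn, hC.consistent n hn]
    exact Finset.sum_congr rfl fun d _ => by rw [hP.measureReal_eq hC hq (by omega)]

theorem HasProductForm.exists_measure (hρ : ∀ k, 1 ≤ ρ k)
    (hC : IsConstrainedCompositionStructure ρ P C)
    (hq : ∀ k, IsDecrementMatrix (q k)) (hP : HasProductForm ρ P C q) {k : ℕ}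
    (hk : ∃ n : ℕ, P {ω | k < (C n ω).length} ≠ 0) :
    ∃ μ : Measure unitInterval, IsProbabilityMeasure μ ∧ ∀ n m : ℕ, 1 ≤ m → m ≤ n →
      q k n m = residualMatrix (ρ k) μ Subtype.val n m := by
  obtain ⟨n, hn⟩ := hk
  obtain ⟨c, hc, hkc⟩ : ∃ c : Composition n, P {ω | C n ω = c} ≠ 0 ∧ k < c.length := by
    by_contra! hcon
    refine hn ?_
    rw [← nonpos_iff_eq_zero]
    calc P {ω | k < (C n ω).length}
        ≤ P (⋃ c ∈ {c : Composition n | k < c.length}, {ω | C n ω = c}) := by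
          refine measure_mono fun ω hω => ?_
          simpa using hω
      _ ≤ 0 := by
          rw [nonpos_iff_eq_zero, measure_biUnion_null_iff (Set.to_countable _)]
          intro c hc
          by_contra h
          exact absurd (hcon c h) (not_le.2 hc)
  have hn1 : 1 ≤ n := c.length_pos_iff.1 (by omega : 0 < c.length)
  refine (hP.isConsistentDecrement hρ hC hq).exists_measure (l := c.blocks)
    (fun i hi => c.blocks_pos hi) hkc ?_
  rw [← hP.measureReal_eq hC hq hn1]
  exact fun h => hc ((measureReal_eq_zero_iff).1 h)

/-- If none of the first `k` factors vanishes at a composition with more than `k` parts, then these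
parts can be completed to a composition of positive probability. -/
theorem exists_decrementProd_ne_zero {l : List ℕ} (hq : ∀ k, IsDecrementMatrix (q k))
    (hl : ∀ i ∈ l, 0 < i) {k : ℕ} (hk : k < l.length)
    (hne : ∀ (j : ℕ) (h : j < l.length), j < k → q j (l.drop j).sum l[j] ≠ 0) :
    ∃ l' : List ℕ, (∀ i ∈ l', 0 < i) ∧ l'.sum = l.sum ∧ k < l'.length ∧
      decrementProd q l' ≠ 0 := by
  induction k generalizing q l with
  | zero =>
    have hs : 1 ≤ l.sum := by
      obtain ⟨a, u, rfl⟩ := List.exists_cons_of_length_pos hk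
      have := hl a (by simp)
      simp; omega
    obtain ⟨c, -, hc⟩ := Finset.exists_ne_zero_of_sum_ne_zero
      (by rw [sum_decrementProd hq l.sum]; exact one_ne_zero)
    exact ⟨c.blocks, fun i hi => c.blocks_pos hi, c.blocks_sum,
      c.length_pos_iff.2 hs, hc⟩
  | succ k ih =>
    obtain ⟨m, t, rfl⟩ := List.exists_cons_of_length_pos (by omega : 0 < l.length)
    obtain ⟨t', h1, h2, h3, h4⟩ := ih (q := fun k => q (k + 1)) (l := t) (fun k => hq (k + 1))
      (fun i hi => hl i (List.mem_cons_of_mem _ hi)) (by simpa using hk)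
      (fun j h hj => hne (j + 1) (by simpa using h) (by omega))
    refine ⟨m :: t', ?_, by simp [h2], by simpa using h3, ?_⟩
    · intro i hi
      rcases List.mem_cons.1 hi with rfl | hi
      · exact hl _ (by simp)
      · exact h1 i hi
    -- The completion keeps the total of the tail, so the first factor is unchanged.
    · rw [decrementProd, h2]
      exact mul_ne_zero (hne 0 (by simp) (by omega)) h4

theorem HasProductForm.reachable (hC : IsConstrainedCompositionStructure ρ P C)
    (hq : ∀ k, IsDecrementMatrix (q k)) (hP : HasProductForm ρ P C q) {n : ℕ}
    (c : Composition n) {k : ℕ} (hk : k < c.blocks.length)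
    (hne : ∀ (j : ℕ) (h : j < c.blocks.length), j < k →
      q j (c.blocks.drop j).sum c.blocks[j] ≠ 0) :
    ∃ n : ℕ, P {ω | k < (C n ω).length} ≠ 0 := by
  obtain ⟨l, hl, hs, hkl, h⟩ := exists_decrementProd_ne_zero hq (fun i hi => c.blocks_pos hi) hk hne
  rw [c.blocks_sum] at hs
  have hn : 1 ≤ n := c.length_pos_iff.1 (Nat.zero_lt_of_lt hk)
  have hm := hP.measureReal_eq hC hq hn ⟨l, fun {i} hi => hl i hi, hs⟩
  refine ⟨n, fun h0 => h ?_⟩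
  simp only at hm
  rw [← hm, measureReal_def, measure_mono_null _ h0, ENNReal.toReal_zero]
  intro ω hω
  have hω : C n ω = _ := hω
  simp [hω, Composition.length, hkl]

/-- Changing the decrement matrices of parts that do not occur does not affect the product form. -/
theorem HasProductForm.congr (hC : IsConstrainedCompositionStructure ρ P C)
    (hq : ∀ k, IsDecrementMatrix (q k)) (hP : HasProductForm ρ P C q) {q' : ℕ → ℕ → ℕ → ℝ}
    (hqq' : ∀ k : ℕ, (∃ n : ℕ, P {ω | k < (C n ω).length} ≠ 0) →
      ∀ n m : ℕ, 1 ≤ m → m ≤ n → q k n m = q' k n m) :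
    HasProductForm ρ P C q' := by
  intro n hn c hc
  rw [hP n hn c hc]
  have heq : ∀ k : Fin c.length, (∀ j : Fin c.length, j < k →
      q j (c.blocks.drop j).sum (c.blocksFun j) ≠ 0) →
      q k (c.blocks.drop k).sum (c.blocksFun k) = q' k (c.blocks.drop k).sum (c.blocksFun k) := by
    intro k hk
    refine hqq' k (hP.reachable hC hq c k.2 fun j h hj => hk ⟨j, h⟩ hj) _ _
      (c.one_le_blocksFun k) ?_
    refine List.le_sum_of_mem ?_
    rw [List.drop_eq_getElem_cons k.2]
    exact List.mem_cons_self
  by_cases hz : ∃ k : Fin c.length, q k (c.blocks.drop k).sum (c.blocksFun k) = 0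
  -- At the first vanishing factor all earlier ones are nonzero, so that part does occur; there `q'`
  -- agrees with `q`, and both products are zero.
  · obtain ⟨k, hk, hmin⟩ := WellFounded.has_min (wellFounded_lt (α := Fin c.length))
      {k | q k (c.blocks.drop k).sum (c.blocksFun k) = 0} hz
    rw [Set.mem_ofPred_eq] at hk
    have hk' := heq k fun j hj hj0 => hmin j hj0 hj
    rw [Finset.prod_eq_zero (Finset.mem_univ k) hk,
      Finset.prod_eq_zero (Finset.mem_univ k) (hk' ▸ hk)]
  · push Not at hz
    exact Finset.prod_congr rfl fun k _ => heq k fun j _ => hz j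

end

/-! ### The converse, and independent variables with the required laws. -/

/-- For `n ≥ r` the row is a mixture of binomial laws on `n - r` trials, shifted by `r ≥ 1`; for `n
< r` it is a unit mass. -/
theorem isDecrementMatrix_residualMatrix {Ω : Type*} [MeasurableSpace Ω] {P : Measure Ω}
    [IsProbabilityMeasure P] {W : Ω → ℝ} (hW : Measurable W)
    (hW1 : ∀ ω, W ω ∈ Set.Icc (0 : ℝ) 1) {r : ℕ} (hr : 1 ≤ r) :
    IsDecrementMatrix (residualMatrix r P W) where
  nonneg n m _ _ := mul_nonneg (Nat.cast_nonneg _) <| integral_nonneg fun ω =>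
    mul_nonneg (pow_nonneg (by linarith [(hW1 ω).2]) _) (pow_nonneg (hW1 ω).1 _)
  sum_eq_one n hn := by
    rcases lt_or_ge n r with h | h
    · rw [Finset.sum_eq_single_of_mem n (by simp; omega), residualMatrix_self_of_lt _ _ h]
      intro m hm hne
      have := Finset.mem_Icc.1 hm
      exact residualMatrix_eq_zero_of_lt _ _ (by omega) (by omega)
    · obtain ⟨N, rfl⟩ := Nat.exists_eq_add_of_le h
      have hsub : Finset.Ico r (r + N + 1) ⊆ Finset.Icc 1 (r + N) := by
        intro i; simp; omega
      rw [← Finset.sum_subset hsub, Finset.sum_Ico_eq_sum_range]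
      · have hterm : ∀ M ∈ Finset.range (r + N + 1 - r), residualMatrix r P W (r + N) (r + M) =
            ∫ ω, (1 - W ω) ^ M * W ω ^ (N - M) * N.choose M ∂P := by
          intro M hM
          obtain ⟨K, rfl⟩ := Nat.exists_eq_add_of_le
            (by have := Finset.mem_range.1 hM; omega : M ≤ N)
          rw [← add_assoc, residualMatrix_add_add, integral_mul_const, mul_comm]
          simp
        rw [Finset.sum_congr rfl hterm, ← integral_finsetSum, show r + N + 1 - r = N + 1 by omega]
        · simp only [← add_pow]
          simp
        · intro M _
          refine Integrable.of_bound (C := N.choose M) (by fun_prop) (ae_of_all _ fun ω => ?_)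
          obtain ⟨h0, h1⟩ := hW1 ω
          have h2 : 0 ≤ 1 - W ω := by linarith
          rw [Real.norm_of_nonneg (by positivity)]
          refine mul_le_of_le_one_left (by positivity) ?_
          exact mul_le_one₀ (pow_le_one₀ h2 (by linarith)) (by positivity) (pow_le_one₀ h0 h1)
      · intro m hm hm'
        simp only [Finset.mem_Icc, Finset.mem_Ico, not_and, not_lt] at hm hm'
        exact residualMatrix_eq_zero_of_lt _ _ (by omega) (by omega)

/-- Independent variables with prescribed laws on the unit interval. -/
theorem exists_isIndepUnitSequence (μ : ℕ → Measure unitInterval)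
    [∀ k, IsProbabilityMeasure (μ k)] :
    ∃ (Ω : Type) (_ : MeasurableSpace Ω) (P : Measure Ω) (W : ℕ → Ω → ℝ),
      IsIndepUnitSequence P W ∧ ∀ k r n m : ℕ,
        residualMatrix r P (W k) n m = residualMatrix r (μ k) Subtype.val n m := by
  refine ⟨ℕ → unitInterval, inferInstance, Measure.infinitePi μ, fun k ω => ω k,
    ⟨inferInstance, fun k => by fun_prop, fun k ω => (ω k).2, ?_⟩, fun k r n m => ?_⟩
  · exact iIndepFun_infinitePi (P := μ) (X := fun _ (x : unitInterval) => (x : ℝ))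
      fun _ => by fun_prop
  · have h := (measurePreserving_eval_infinitePi μ k).map_eq
    rw [residualMatrix, residualMatrix]
    congr 1
    rw [← h, integral_map (measurable_pi_apply k).aemeasurable
      (Measurable.aestronglyMeasurable (by fun_prop))]

/-- First part: the equivalence. Second part: any decrement matrices that give the product form are
of the stated form, for every `k` such that `C n` has a part number `k` with positive probability
for some `n` (the other matrices do not enter the law of the structure). -/
theorem proposition6 (ρ : ℕ → ℕ) (hρ : ∀ k, 1 ≤ ρ k)
    {Ω : Type*} [MeasurableSpace Ω] (P : Measure Ω) [IsProbabilityMeasure P]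
    (C : ∀ n : ℕ, Ω → Composition n) (hC : IsConstrainedCompositionStructure ρ P C) :
    ((∃ q : ℕ → ℕ → ℕ → ℝ, (∀ k, IsDecrementMatrix (q k)) ∧ HasProductForm ρ P C q) ↔
      ∃ q : ℕ → ℕ → ℕ → ℝ, HasProductForm ρ P C q ∧
        ∃ (Ω' : Type) (_ : MeasurableSpace Ω') (P' : Measure Ω') (W : ℕ → Ω' → ℝ),
          IsIndepUnitSequence P' W ∧
          ∀ k n m : ℕ, 1 ≤ m → m ≤ n → q k n m = residualMatrix (ρ k) P' (W k) n m) ∧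
    ∀ q : ℕ → ℕ → ℕ → ℝ, (∀ k, IsDecrementMatrix (q k)) → HasProductForm ρ P C q →
      ∃ (Ω' : Type) (_ : MeasurableSpace Ω') (P' : Measure Ω') (W : ℕ → Ω' → ℝ),
        IsIndepUnitSequence P' W ∧
        ∀ k : ℕ, (∃ n : ℕ, P {ω | k < (C n ω).length} ≠ 0) →
          ∀ n m : ℕ, 1 ≤ m → m ≤ n → q k n m = residualMatrix (ρ k) P' (W k) n m := by
  have main : ∀ q : ℕ → ℕ → ℕ → ℝ, (∀ k, IsDecrementMatrix (q k)) → HasProductForm ρ P C q →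
      ∃ (Ω' : Type) (_ : MeasurableSpace Ω') (P' : Measure Ω') (W : ℕ → Ω' → ℝ),
        IsIndepUnitSequence P' W ∧
        ∀ k : ℕ, (∃ n : ℕ, P {ω | k < (C n ω).length} ≠ 0) →
          ∀ n m : ℕ, 1 ≤ m → m ≤ n → q k n m = residualMatrix (ρ k) P' (W k) n m := by
    intro q hq hP
    have hex : ∀ k, ∃ μ : Measure unitInterval, IsProbabilityMeasure μ ∧
        ((∃ n : ℕ, P {ω | k < (C n ω).length} ≠ 0) → ∀ n m : ℕ, 1 ≤ m → m ≤ n →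
          q k n m = residualMatrix (ρ k) μ Subtype.val n m) := by
      intro k
      by_cases hk : ∃ n : ℕ, P {ω | k < (C n ω).length} ≠ 0
      · obtain ⟨μ, hμ, h⟩ := hP.exists_measure hρ hC hq hk
        exact ⟨μ, hμ, fun _ => h⟩
      -- For parts that never occur any law will do.
      · exact ⟨Measure.dirac 0, inferInstance, fun h => absurd h hk⟩
    choose μ hμ hform using hex
    obtain ⟨Ω', _, P', W, hW, hres⟩ := exists_isIndepUnitSequence μ
    refine ⟨Ω', _, P', W, hW, fun k hk n m hm hmn => ?_⟩
    rw [hres, hform k hk n m hm hmn]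
  refine ⟨⟨?_, ?_⟩, main⟩
  · rintro ⟨q, hq, hP⟩
    obtain ⟨Ω', _, P', W, hW, h⟩ := main q hq hP
    -- The given `q k` may be arbitrary for parts that never occur, so the residual matrices replace
    -- `q` throughout.
    exact ⟨fun k => residualMatrix (ρ k) P' (W k), hP.congr hC hq h, Ω', _, P', W, hW,
      fun _ _ _ _ _ => rfl⟩
  · rintro ⟨q, hP, Ω', _, P', W, hW, h⟩
    have := hW.isProbabilityMeasure
    refine ⟨q, fun k => ?_, hP⟩
    have hd := isDecrementMatrix_residualMatrix (P := P') (hW.measurable k) (hW.mem_Icc k) (hρ k)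
    refine ⟨fun n m hm hmn => ?_, fun n hn => ?_⟩
    · rw [h k n m hm hmn]
      exact hd.nonneg n m hm hmn
    · rw [← hd.sum_eq_one n hn]
      refine Finset.sum_congr rfl fun m hm => ?_
      have hm := Finset.mem_Icc.1 hm
      exact h k n m hm.1 hm.2
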